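/- Let $d\in\mathbb N$ and let $L=L(x,t,\xi):\mathbb R^d\times\mathbb R\times\mathbb R^d\to\mathbb R$ satisfy: (L1) $L$ is $C^2$; (L2) the Hessian matrix $\frac{\partial^2L}{\partial\xi^2}(x,t,\xi)$ is positive definite for every $(x,t,\xi)$; (L3) for each $a\ge 0$ there is $b_a\in\mathbb R$ with $L(x,t,\xi)\ge a|\xi|+b_a$ for all $(x,t,\xi)$; (L4) the Euler--Lagrange flow of $L$ is complete, i.e. for all $t_0\in\mathbb R$ and $x_0,\xi_0\in\mathbb R^d$ there is a $C^2$ curve $\gamma:\mathbb R\to\mathbb R^d$ with $\gamma(t_0)=x_0$, $\gamma'(t_0)=\xi_0$ and $\frac{d}{ds}\frac{\partial L}{\partial\xi}(\gamma(s),s,\gamma'(s))=\frac{\partial L}{\partial x}(\gamma(s),s,\gamma'(s))$ for all $s\in\mathbb R$. Let $w:\mathbb R^d\to\mathbb R$ be continuous and suppose there are $\alpha\ge0$, $\beta\in\mathbb R$ with $w(x)\ge-\alpha|x|+\beta$ for all $x$. Let $t>0$. Let $C^1_{\rm pw}([0,t];\mathbb R^d)$ be the set of continuous curves $\gamma:[0,t]\to\mathbb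 R^d$ for which there is a finite division $0=\tau_0<\tau_1<\dots<\tau_m=t$, $m\ge1$, such that $\gamma$ is $C^1$ on each closed interval $[\tau_{l-1},\tau_l]$, and let ${\rm Lip}([0,t];\mathbb R^d)$ be the set of Lipschitz continuous curves $\gamma:[0,t]\to\mathbb R^d$. Put $$\mathcal L_w(\gamma)=\int_0^tL(\gamma(s),s,\gamma'(s))\,ds+w(\gamma(0)),$$ and write $\mathcal L_0$ for $\mathcal L_w$ with $w=0$. Then the following hold. 1. For every $\gamma\in{\rm Lip}([0,t];\mathbb R^d)$ the function $s\mapsto L(\gamma(s),s,\gamma'(s))$ (defined for a.e. $s$) is integrable on $[0,t]$, so that $\mathcal L_w(\gamma)\in\mathbb R$. 2. (Free initial point.) Let $x\in\mathbb R^d$. If $\gamma^*$ minimizes $\mathcal L_w$ among all $\gamma\in C^1_{\rm pw}([0,t];\mathbb R^d)$ with $\gamma(t)=x$, then $\gamma^*$ belongs to ${\rm Lip}([0,t];\mathbb R^d)$ and minimizes $\mathcal L_w$ among all $\gamma\in{\rm Lip}([0,t];\mathbb R^d)$ with $\gamma(t)=x$. 3. (Two fixed end points.) Let $x,\tilde x\in\mathbb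 R^d$. If $\gamma^*$ minimizes $\mathcal L_0$ among all $\gamma\in C^1_{\rm pw}([0,t];\mathbb R^d)$ with $\gamma(t)=x$ and $\gamma(0)=\tilde x$, then $\gamma^*$ belongs to ${\rm Lip}([0,t];\mathbb R^d)$ and minimizes $\mathcal L_0$ among all $\gamma\in{\rm Lip}([0,t];\mathbb R^d)$ with $\gamma(t)=x$ and $\gamma(0)=\tilde x$. -/

import Mathlib

open Set MeasureTheory

noncomputable section

/-- The configuration space `ℝ^d` with its Euclidean norm and inner product. -/
abbrev Conf (d : ℕ) : Type := EuclideanSpace ℝ (Fin d)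

/-- The Hessian matrix `[∂²f / ∂ξ^i ∂ξ^j]` at `ξ` of a real function on `ℝ^d`. -/
def hessianMatrix {d : ℕ} (f : Conf d → ℝ) (ξ : Conf d) : Matrix (Fin d) (Fin d) ℝ :=
  Matrix.of fun i j =>
    fderiv ℝ (fun η => fderiv ℝ f η (EuclideanSpace.single j 1)) ξ (EuclideanSpace.single i 1)

/-- The Euler-Lagrange equation `d/ds (∂L/∂ξ)(γ(s), s, γ'(s)) = (∂L/∂x)(γ(s), s, γ'(s))`
at time `s`, where `L x t ξ` is the Lagrangian. -/
def EulerLagrangeAt {d : ℕ} (L : Conf d → ℝ → Conf d → ℝ) (γ : ℝ → Conf d) (s : ℝ) : Prop :=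
  HasDerivAt (fun r => gradient (fun ξ => L (γ r) r ξ) (deriv γ r))
    (gradient (fun y => L y s (deriv γ s)) (γ s)) s

/-- The standing assumptions on the Lagrangian. -/
structure IsTonelliLagrangian {d : ℕ} (L : Conf d → ℝ → Conf d → ℝ) : Prop where
  /-- `L` is of class `C²` on `ℝ^d × ℝ × ℝ^d`. -/
  contDiff : ContDiff ℝ 2 (fun q : Conf d × ℝ × Conf d => L q.1 q.2.1 q.2.2)
  /-- The Hessian of `L` in the velocity variable is positive definite everywhere. -/
  hessian_posDef : ∀ x t ξ, (hessianMatrix (fun η => L x t η) ξ).PosDef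
  /-- `L` is uniformly superlinear. -/
  superlinear : ∀ a : ℝ, 0 ≤ a → ∃ b : ℝ, ∀ x t ξ, a * ‖ξ‖ + b ≤ L x t ξ
  /-- The Euler-Lagrange flow is complete: for all initial data, the (unique) solution of the
  initial value problem exists for all times. -/
  complete : ∀ (t₀ : ℝ) (x₀ ξ₀ : Conf d), ∃ γ : ℝ → Conf d,
    ContDiff ℝ 2 γ ∧ γ t₀ = x₀ ∧ deriv γ t₀ = ξ₀ ∧ ∀ s, EulerLagrangeAt L γ s

/-! A curve `[0,t] → ℝ^d` is represented by a function on `ℝ` of which only the restriction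
to `[0,t]` matters in each of the following definitions. -/

/-- `C¹_pw([0,t]; ℝ^d)`: continuous curves on `[0,t]` with a finite division
`0 = τ₀ < τ₁ < ⋯ < τ_m = t`, `m ≥ 1`, such that the curve is `C¹` on each closed interval
`[τ_{l-1}, τ_l]`. -/
def PiecewiseC1 (d : ℕ) (t : ℝ) : Set (ℝ → Conf d) :=
  {γ | ContinuousOn γ (Icc 0 t) ∧
    ∃ m : ℕ, 1 ≤ m ∧ ∃ τ : Fin (m + 1) → ℝ, StrictMono τ ∧ τ 0 = 0 ∧ τ (Fin.last m) = t ∧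
      ∀ l : Fin m, ContDiffOn ℝ 1 γ (Icc (τ l.castSucc) (τ l.succ))}

/-- `Lip([0,t]; ℝ^d)`: curves that are Lipschitz continuous on `[0,t]`. -/
def LipschitzCurves (d : ℕ) (t : ℝ) : Set (ℝ → Conf d) :=
  {γ | ∃ K : NNReal, LipschitzOnWith K γ (Icc 0 t)}

/-- The integrand `s ↦ L(γ(s), s, γ'(s))` of the action over `[0,t]`. -/
def lagrangianAlong {d : ℕ} (L : Conf d → ℝ → Conf d → ℝ) (t : ℝ) (γ : ℝ → Conf d) (s : ℝ) : ℝ :=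
  L (γ s) s (derivWithin γ (Icc 0 t) s)

/-- The action `∫₀ᵗ L(γ(s), s, γ'(s)) ds + w(γ(0))`. -/
def action {d : ℕ} (L : Conf d → ℝ → Conf d → ℝ) (w : Conf d → ℝ) (t : ℝ)
    (γ : ℝ → Conf d) : ℝ :=
  (∫ s in (0 : ℝ)..t, lagrangianAlong L t γ s) + w (γ 0)

/-- `γ` is a minimizer of the functional `F` over the class `S` (and belongs to `S`). -/
def IsMinimizerIn {d : ℕ} (F : (ℝ → Conf d) → ℝ) (S : Set (ℝ → Conf d)) (γ : ℝ → Conf d) : Prop :=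
  γ ∈ S ∧ ∀ η ∈ S, F γ ≤ F η

end

/-! `C¹` curves approximate any Lipschitz curve in action without moving its end points, so passing
from piecewise `C¹` to Lipschitz competitors cannot lower the infimum. Averaging a Lipschitz curve
over `[s, s + h]` gives a `C¹` curve, and an affine correction of size `O(h)` restores the end
points. As `h → 0+` these curves converge, their velocities are bounded and converge almost
everywhere, and `L` is continuous, so dominated convergence gives convergence of the actions
(`tendsto_integral_pinnedAverage`). Both minimality claims then follow from
`le_action_of_forall_contDiff`. -/

/-! ### Smoothing with fixed end points -/

/-- The forward average of `f` over a window of length `h`. -/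
noncomputable def forwardAverage {d : ℕ} (f : ℝ → Conf d) (h s : ℝ) : Conf d :=
  h⁻¹ • ((∫ r in (0 : ℝ)..(s + h), f r) - ∫ r in (0 : ℝ)..s, f r)

theorem hasDerivAt_forwardAverage {d : ℕ} {f : ℝ → Conf d} (hf : Continuous f) (h s : ℝ) :
    HasDerivAt (forwardAverage f h) (h⁻¹ • (f (s + h) - f s)) s := by
  have key : ∀ u, HasDerivAt (fun v => ∫ r in (0 : ℝ)..v, f r) (f u) u := fun u =>
    intervalIntegral.integral_hasDerivAt_right (hf.intervalIntegrable _ _)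
      (hf.stronglyMeasurableAtFilter _ _) hf.continuousAt
  exact (((key (s + h)).comp_add_const s h).sub (key s)).const_smul h⁻¹

theorem norm_forwardAverage_sub_le {d : ℕ} {f : ℝ → Conf d} {K : NNReal}
    (hf : LipschitzWith K f) {h : ℝ} (hh : 0 < h) (s : ℝ) :
    ‖forwardAverage f h s - f s‖ ≤ K * h := by
  have hint : ∀ a b, IntervalIntegrable f volume a b := fun a b =>
    hf.continuous.intervalIntegrable a b
  have heq : forwardAverage f h s - f s = h⁻¹ • ∫ r in s..(s + h), (f r - f s) := by
    rw [intervalIntegral.integral_sub (hint _ _) intervalIntegrable_const,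
      intervalIntegral.integral_const, add_sub_cancel_left, smul_sub, smul_smul,
      inv_mul_cancel₀ hh.ne', one_smul, forwardAverage,
      intervalIntegral.integral_interval_sub_left (hint _ _) (hint _ _)]
  have hb : ‖∫ r in s..(s + h), (f r - f s)‖ ≤ K * h * |s + h - s| := by
    refine intervalIntegral.norm_integral_le_of_norm_le_const fun r hr => ?_
    rw [uIoc_of_le (by linarith)] at hr
    refine (hf.norm_sub_le r s).trans (mul_le_mul_of_nonneg_left ?_ K.2)
    rw [Real.norm_eq_abs, abs_le]
    constructor <;> linarith [hr.1, hr.2]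
  rw [add_sub_cancel_left, abs_of_pos hh] at hb
  rw [heq, norm_smul, norm_inv, Real.norm_eq_abs, abs_of_pos hh, inv_mul_le_iff₀ hh]
  linarith

/-- The forward average of `f`, corrected by an affine curve so as to agree with `f` at the
end points `0` and `t`. -/
noncomputable def pinnedAverage {d : ℕ} (f : ℝ → Conf d) (t h s : ℝ) : Conf d :=
  forwardAverage f h s + ((f 0 - forwardAverage f h 0) +
    (s / t) • ((f t - forwardAverage f h t) - (f 0 - forwardAverage f h 0)))

theorem pinnedAverage_zero {d : ℕ} (f : ℝ → Conf d) (t h : ℝ) :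
    pinnedAverage f t h 0 = f 0 := by
  simp [pinnedAverage]

theorem pinnedAverage_right {d : ℕ} (f : ℝ → Conf d) {t : ℝ} (ht : t ≠ 0) (h : ℝ) :
    pinnedAverage f t h t = f t := by
  rw [pinnedAverage, div_self ht, one_smul]
  abel

theorem hasDerivAt_pinnedAverage {d : ℕ} {f : ℝ → Conf d} (hf : Continuous f) (t h s : ℝ) :
    HasDerivAt (pinnedAverage f t h) (h⁻¹ • (f (s + h) - f s) +
      (1 / t) • ((f t - forwardAverage f h t) - (f 0 - forwardAverage f h 0))) s :=
  (hasDerivAt_forwardAverage hf h s).add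
    ((((hasDerivAt_id s).div_const t).smul_const _).const_add _)

theorem contDiff_pinnedAverage {d : ℕ} {f : ℝ → Conf d} (hf : Continuous f) (t h : ℝ) :
    ContDiff ℝ 1 (pinnedAverage f t h) := by
  rw [contDiff_one_iff_deriv]
  refine ⟨fun s => (hasDerivAt_pinnedAverage hf t h s).differentiableAt, ?_⟩
  rw [funext fun s => (hasDerivAt_pinnedAverage hf t h s).deriv]
  fun_prop

theorem norm_endpoint_correction_le {d : ℕ} {f : ℝ → Conf d} {K : NNReal}
    (hf : LipschitzWith K f) (t : ℝ) {h : ℝ} (hh : 0 < h) :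
    ‖(f t - forwardAverage f h t) - (f 0 - forwardAverage f h 0)‖ ≤ 2 * K * h := by
  have h1 := norm_forwardAverage_sub_le hf hh t
  have h2 := norm_forwardAverage_sub_le hf hh 0
  rw [norm_sub_rev] at h1 h2
  exact (norm_sub_le _ _).trans (by linarith)

/-- The constant is `4 = 1 + 1 + 2`: the averaging errors at `s` and at `0`, and the affine term,
whose weight `s / t` is at most `1`. -/
theorem norm_pinnedAverage_sub_le {d : ℕ} {f : ℝ → Conf d} {K : NNReal}
    (hf : LipschitzWith K f) {t h s : ℝ} (hh : 0 < h) (hs : s ∈ Icc 0 t) :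
    ‖pinnedAverage f t h s - f s‖ ≤ 4 * K * h := by
  have h1 := norm_forwardAverage_sub_le hf hh s
  have h2 := norm_forwardAverage_sub_le hf hh 0
  have h3 := norm_endpoint_correction_le hf t hh
  rw [norm_sub_rev] at h2
  have h4 : ‖(s / t) • ((f t - forwardAverage f h t) - (f 0 - forwardAverage f h 0))‖
      ≤ 2 * K * h := by
    rw [norm_smul, Real.norm_eq_abs, abs_of_nonneg (div_nonneg hs.1 (hs.1.trans hs.2))]
    exact (mul_le_of_le_one_left (norm_nonneg _)
      (div_le_one_of_le₀ hs.2 (hs.1.trans hs.2))).trans h3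
  calc ‖pinnedAverage f t h s - f s‖
      = ‖(forwardAverage f h s - f s) + ((f 0 - forwardAverage f h 0) +
        (s / t) • ((f t - forwardAverage f h t) - (f 0 - forwardAverage f h 0)))‖ := by
        rw [pinnedAverage]; congr 1; abel
    _ ≤ _ := (norm_add_le _ _).trans (add_le_add_right (norm_add_le _ _) _)
    _ ≤ _ := by linarith

theorem norm_deriv_pinnedAverage_le {d : ℕ} {f : ℝ → Conf d} {K : NNReal}
    (hf : LipschitzWith K f) {t h : ℝ} (ht : 0 < t) (hh : 0 < h) (s : ℝ) :
    ‖deriv (pinnedAverage f t h) s‖ ≤ K + 1 / t * (2 * K * h) := by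
  rw [(hasDerivAt_pinnedAverage hf.continuous t h s).deriv]
  refine (norm_add_le _ _).trans (add_le_add ?_ ?_)
  · have := hf.norm_sub_le (s + h) s
    rw [add_sub_cancel_left, Real.norm_eq_abs, abs_of_pos hh] at this
    rw [norm_smul, norm_inv, Real.norm_eq_abs, abs_of_pos hh, inv_mul_le_iff₀ hh]
    linarith
  · rw [norm_smul, Real.norm_eq_abs, abs_of_pos (by positivity)]
    exact mul_le_mul_of_nonneg_left (norm_endpoint_correction_le hf t hh) (by positivity)

open Filter Topology in
theorem tendsto_pinnedAverage {d : ℕ} {f : ℝ → Conf d} {K : NNReal}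
    (hf : LipschitzWith K f) {t s : ℝ} (hs : s ∈ Icc 0 t) :
    Tendsto (fun h => pinnedAverage f t h s) (𝓝[>] 0) (𝓝 (f s)) := by
  rw [tendsto_iff_norm_sub_tendsto_zero]
  have hlim : Tendsto (fun h : ℝ => 4 * K * h) (𝓝[>] 0) (𝓝 0) := by
    have : Continuous fun h : ℝ => 4 * K * h := by fun_prop
    simpa using (this.tendsto 0).mono_left nhdsWithin_le_nhds
  refine squeeze_zero' (.of_forall fun h => norm_nonneg _) ?_ hlim
  filter_upwards [self_mem_nhdsWithin] with h hh using norm_pinnedAverage_sub_le hf hh hs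

-- The derivative of the forward average is the difference quotient of `f` with step `h`; the slope
-- of the affine correction is `O(h)`.
open Filter Topology in
theorem tendsto_deriv_pinnedAverage {d : ℕ} {f : ℝ → Conf d} {K : NNReal}
    (hf : LipschitzWith K f) (t : ℝ) {s : ℝ} (hd : DifferentiableAt ℝ f s) :
    Tendsto (fun h => deriv (pinnedAverage f t h) s) (𝓝[>] 0) (𝓝 (deriv f s)) := by
  simp_rw [fun h => (hasDerivAt_pinnedAverage hf.continuous t h s).deriv]
  have h1 := hd.hasDerivAt.tendsto_slope_zero_right
  have h2 : Tendsto (fun h => (f t - forwardAverage f h t) - (f 0 - forwardAverage f h 0))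
      (𝓝[>] 0) (𝓝 0) := by
    rw [tendsto_zero_iff_norm_tendsto_zero]
    have hlim : Tendsto (fun h : ℝ => 2 * K * h) (𝓝[>] 0) (𝓝 0) := by
      have : Continuous fun h : ℝ => 2 * K * h := by fun_prop
      simpa using (this.tendsto 0).mono_left nhdsWithin_le_nhds
    refine squeeze_zero' (.of_forall fun h => norm_nonneg _) ?_ hlim
    filter_upwards [self_mem_nhdsWithin] with h hh using norm_endpoint_correction_le hf t hh
  simpa using h1.add (h2.const_smul (1 / t))

/-! ### Convergence of the action integral -/

theorem exists_bound_of_continuous {d : ℕ} {F : Conf d × ℝ × Conf d → ℝ} (hF : Continuous F)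
    (t M R : ℝ) : ∃ C, ∀ s ∈ Icc 0 t, ∀ x v, ‖x‖ ≤ M → ‖v‖ ≤ R → ‖F (x, s, v)‖ ≤ C := by
  obtain ⟨C, hC⟩ := ((isCompact_closedBall (0 : Conf d) M).prod
    ((isCompact_Icc (a := (0 : ℝ)) (b := t)).prod
      (isCompact_closedBall (0 : Conf d) R))).exists_bound_of_continuousOn hF.continuousOn
  exact ⟨C, fun s hs x v hx hv => hC _ ⟨by simpa using hx, hs, by simpa using hv⟩⟩

theorem LipschitzWith.exists_norm_le_on_Icc {d : ℕ} {f : ℝ → Conf d} {K : NNReal}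
    (hf : LipschitzWith K f) (t : ℝ) : ∃ M, ∀ s ∈ Icc 0 t, ‖f s‖ ≤ M :=
  isCompact_Icc.exists_bound_of_continuousOn hf.continuous.continuousOn

theorem measurable_comp_deriv {d : ℕ} {F : Conf d × ℝ × Conf d → ℝ} (hF : Continuous F)
    {f : ℝ → Conf d} (hf : Continuous f) : Measurable fun s => F (f s, s, deriv f s) :=
  hF.measurable.comp (hf.measurable.prodMk (measurable_id.prodMk (measurable_deriv f)))

theorem intervalIntegrable_comp_deriv {d : ℕ} {F : Conf d × ℝ × Conf d → ℝ} (hF : Continuous F)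
    {f : ℝ → Conf d} {K : NNReal} (hf : LipschitzWith K f) {t : ℝ} (ht : 0 ≤ t) :
    IntervalIntegrable (fun s => F (f s, s, deriv f s)) volume 0 t := by
  obtain ⟨M, hM⟩ := hf.exists_norm_le_on_Icc t
  obtain ⟨C, hC⟩ := exists_bound_of_continuous hF t M K
  refine (intervalIntegrable_const (c := C)).mono_fun'
    (measurable_comp_deriv hF hf.continuous).aestronglyMeasurable ?_
  refine (ae_restrict_iff' measurableSet_uIoc).2 (.of_forall fun s hs => ?_)
  rw [uIoc_of_le ht] at hs
  exact hC s ⟨hs.1.le, hs.2⟩ _ _ (hM s ⟨hs.1.le, hs.2⟩) (norm_deriv_le_of_lipschitz hf)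

open Filter Topology in
theorem tendsto_integral_pinnedAverage {d : ℕ} {F : Conf d × ℝ × Conf d → ℝ} (hF : Continuous F)
    {f : ℝ → Conf d} {K : NNReal} (hf : LipschitzWith K f) {t : ℝ} (ht : 0 < t) :
    Tendsto (fun h => ∫ s in (0 : ℝ)..t, F (pinnedAverage f t h s, s, deriv (pinnedAverage f t h) s))
      (𝓝[>] 0) (𝓝 (∫ s in (0 : ℝ)..t, F (f s, s, deriv f s))) := by
  obtain ⟨M, hM⟩ := hf.exists_norm_le_on_Icc t
  -- Only `h ≤ 1` matters in the limit, so the bounds at `h = 1` serve for all `h`.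
  obtain ⟨C, hC⟩ := exists_bound_of_continuous hF t (M + 4 * K * 1) (K + 1 / t * (2 * K * 1))
  refine intervalIntegral.tendsto_integral_filter_of_dominated_convergence (fun _ => C)
    (.of_forall fun h => (measurable_comp_deriv hF
      (contDiff_pinnedAverage hf.continuous t h).continuous).aestronglyMeasurable) ?_
    intervalIntegrable_const ?_
  · filter_upwards [Ioc_mem_nhdsGT (zero_lt_one' ℝ)] with h hh
    refine .of_forall fun s hs => ?_
    rw [uIoc_of_le ht.le] at hs
    have hs' : s ∈ Icc 0 t := ⟨hs.1.le, hs.2⟩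
    refine hC s hs' _ _ ?_ ?_
    · have h1 := norm_pinnedAverage_sub_le hf hh.1 hs'
      have h2 : ‖pinnedAverage f t h s‖ ≤ ‖f s‖ + ‖pinnedAverage f t h s - f s‖ :=
        norm_le_insert' _ _
      have h3 : 4 * K * h ≤ 4 * K * 1 := mul_le_mul_of_nonneg_left hh.2 (by positivity)
      linarith [hM s hs']
    · refine (norm_deriv_pinnedAverage_le hf ht hh.1 s).trans ?_
      gcongr
      exact hh.2
  -- Rademacher's theorem in one variable.
  · filter_upwards [hf.ae_differentiableAt_real] with s hd hs
    rw [uIoc_of_le ht.le] at hs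
    exact (hF.tendsto _).comp ((tendsto_pinnedAverage hf ⟨hs.1.le, hs.2⟩).prodMk_nhds
      (tendsto_const_nhds.prodMk_nhds (tendsto_deriv_pinnedAverage hf t hd)))

/-! ### Curves on `[0, t]` and their actions -/

/-- Forward averages near `t` use values beyond `t`; extending by the end values keeps the constant
`K`. -/
theorem LipschitzOnWith.exists_extend_Icc {d : ℕ} {γ : ℝ → Conf d} {K : NNReal} {t : ℝ}
    (ht : 0 ≤ t) (hγ : LipschitzOnWith K γ (Icc 0 t)) :
    ∃ f : ℝ → Conf d, LipschitzWith K f ∧ EqOn γ f (Icc 0 t) := by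
  refine ⟨fun s => γ (projIcc 0 t ht s), ?_, fun s hs => ?_⟩
  · simpa [Function.comp_def] using hγ.to_restrict.comp (LipschitzWith.projIcc ht)
  · simp only [projIcc_of_mem ht hs]

theorem lagrangianAlong_eq_of_eqOn {d : ℕ} (L : Conf d → ℝ → Conf d → ℝ) {t : ℝ}
    {γ f : ℝ → Conf d} (h : EqOn γ f (Icc 0 t)) {s : ℝ} (hs : s ∈ Ioo 0 t) :
    lagrangianAlong L t γ s = L (f s) s (deriv f s) := by
  rw [lagrangianAlong, derivWithin_congr h (h (Ioo_subset_Icc_self hs)),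
    derivWithin_of_mem_nhds (Icc_mem_nhds hs.1 hs.2), h (Ioo_subset_Icc_self hs)]

theorem lagrangianAlong_ae_eq_of_eqOn {d : ℕ} (L : Conf d → ℝ → Conf d → ℝ) {t : ℝ} (ht : 0 ≤ t)
    {γ f : ℝ → Conf d} (h : EqOn γ f (Icc 0 t)) :
    ∀ᵐ s ∂volume, s ∈ uIoc 0 t → lagrangianAlong L t γ s = L (f s) s (deriv f s) := by
  -- At `s = t` the one-sided derivative may differ from `deriv f`.
  filter_upwards [Measure.ae_ne volume t] with s hst hs
  rw [uIoc_of_le ht] at hs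
  exact lagrangianAlong_eq_of_eqOn L h ⟨hs.1, lt_of_le_of_ne hs.2 hst⟩

theorem action_eq_of_eqOn {d : ℕ} (L : Conf d → ℝ → Conf d → ℝ) (w : Conf d → ℝ) {t : ℝ}
    (ht : 0 ≤ t) {γ f : ℝ → Conf d} (h : EqOn γ f (Icc 0 t)) :
    action L w t γ = (∫ s in (0 : ℝ)..t, L (f s) s (deriv f s)) + w (f 0) := by
  rw [action, intervalIntegral.integral_congr_ae (lagrangianAlong_ae_eq_of_eqOn L ht h),
    h ⟨le_rfl, ht⟩]

theorem intervalIntegrable_lagrangianAlong {d : ℕ} {L : Conf d → ℝ → Conf d → ℝ}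
    (hL : Continuous fun q : Conf d × ℝ × Conf d => L q.1 q.2.1 q.2.2) {t : ℝ} (ht : 0 ≤ t)
    {γ : ℝ → Conf d} (hγ : γ ∈ LipschitzCurves d t) :
    IntervalIntegrable (lagrangianAlong L t γ) volume 0 t := by
  obtain ⟨K, hK⟩ := hγ
  obtain ⟨f, hf, hγf⟩ := hK.exists_extend_Icc ht
  refine (intervalIntegrable_comp_deriv hL hf ht).congr_ae ?_
  refine (ae_restrict_iff' measurableSet_uIoc).2 ?_
  filter_upwards [lagrangianAlong_ae_eq_of_eqOn L ht hγf] with s h hs using (h hs).symm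

theorem ContDiff.mem_piecewiseC1 {d : ℕ} {t : ℝ} (ht : 0 < t) {γ : ℝ → Conf d}
    (hγ : ContDiff ℝ 1 γ) : γ ∈ PiecewiseC1 d t := by
  refine ⟨hγ.continuous.continuousOn, 1, le_rfl, ![0, t], ?_, rfl, rfl,
    fun l => hγ.contDiffOn⟩
  rw [Fin.strictMono_iff_lt_succ]
  intro i
  fin_cases i
  simpa using ht

theorem LipschitzOnWith.union_Icc {d : ℕ} {γ : ℝ → Conf d} {K K' : NNReal} {a b c : ℝ}
    (h₁ : LipschitzOnWith K γ (Icc a b)) (h₂ : LipschitzOnWith K' γ (Icc b c)) :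
    LipschitzOnWith (max K K') γ (Icc a c) := by
  have h₁' := h₁.weaken (le_max_left K K')
  have h₂' := h₂.weaken (le_max_right K K')
  have key : ∀ x ∈ Icc a c, ∀ y ∈ Icc a c, x ≤ y →
      dist (γ x) (γ y) ≤ (max K K' : NNReal) * dist x y := by
    intro x hx y hy hxy
    rcases le_total y b with hyb | hby
    · exact h₁'.dist_le_mul x ⟨hx.1, hxy.trans hyb⟩ y ⟨hy.1, hyb⟩
    rcases le_total b x with hbx | hxb
    · exact h₂'.dist_le_mul x ⟨hbx, hx.2⟩ y ⟨hby, hy.2⟩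
    have e1 := h₁'.dist_le_mul x ⟨hx.1, hxb⟩ b ⟨hx.1.trans hxb, le_rfl⟩
    have e2 := h₂'.dist_le_mul b ⟨le_rfl, hby.trans hy.2⟩ y ⟨hby, hy.2⟩
    have e3 : dist x y = dist x b + dist b y := by
      rw [Real.dist_eq, Real.dist_eq, Real.dist_eq, abs_of_nonpos (sub_nonpos.2 hxb),
        abs_of_nonpos (sub_nonpos.2 hby), abs_of_nonpos (sub_nonpos.2 hxy)]
      ring
    rw [e3, mul_add]
    exact (dist_triangle _ _ _).trans (add_le_add e1 e2)
  refine LipschitzOnWith.of_dist_le_mul fun x hx y hy => ?_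
  rcases le_total x y with h | h
  · exact key x hx y hy h
  · rw [dist_comm, dist_comm x]
    exact key y hy x hx h

theorem piecewiseC1_subset_lipschitzCurves (d : ℕ) (t : ℝ) :
    PiecewiseC1 d t ⊆ LipschitzCurves d t := by
  rintro γ ⟨-, m, -, τ, -, h0, hlast, hC⟩
  have key : ∀ l : Fin (m + 1), ∃ K : NNReal, LipschitzOnWith K γ (Icc 0 (τ l)) := by
    intro l
    induction l using Fin.induction with
    | zero => exact ⟨0, LipschitzOnWith.of_dist_le_mul fun x hx y hy => by
      rw [h0, Icc_self, mem_singleton_iff] at hx hy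
      simp [hx, hy]⟩
    | succ l ih =>
      obtain ⟨K, hK⟩ := ih
      obtain ⟨K', hK'⟩ := (hC l).exists_lipschitzOnWith one_ne_zero (convex_Icc _ _) isCompact_Icc
      exact ⟨_, hK.union_Icc hK'⟩
  exact hlast ▸ key (Fin.last m)

/-- A lower bound for the action on `C¹` curves with the end points of a Lipschitz curve is a
lower bound for the action of that curve. -/
theorem le_action_of_forall_contDiff {d : ℕ} {L : Conf d → ℝ → Conf d → ℝ}
    (hL : Continuous fun q : Conf d × ℝ × Conf d => L q.1 q.2.1 q.2.2) (w : Conf d → ℝ) {t : ℝ}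
    (ht : 0 < t) {γ : ℝ → Conf d} (hγ : γ ∈ LipschitzCurves d t) {c : ℝ}
    (hc : ∀ η : ℝ → Conf d, ContDiff ℝ 1 η → η 0 = γ 0 → η t = γ t → c ≤ action L w t η) :
    c ≤ action L w t γ := by
  obtain ⟨K, hK⟩ := hγ
  obtain ⟨f, hf, hγf⟩ := hK.exists_extend_Icc ht.le
  rw [action_eq_of_eqOn L w ht.le hγf]
  -- The competitors all start at `f 0`, so the initial cost is constant along the limit.
  refine ge_of_tendsto' ((tendsto_integral_pinnedAverage hL hf ht).add_const (w (f 0))) fun h => ?_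
  have := hc (pinnedAverage f t h) (contDiff_pinnedAverage hf.continuous t h)
    ((pinnedAverage_zero f t h).trans (hγf ⟨le_rfl, ht.le⟩).symm)
    ((pinnedAverage_right f ht.ne' h).trans (hγf ⟨ht.le, le_rfl⟩).symm)
  rwa [action_eq_of_eqOn L w ht.le (eqOn_refl _ _), pinnedAverage_zero] at this

theorem mainTheorem3 (d : ℕ) (L : Conf d → ℝ → Conf d → ℝ) (hL : IsTonelliLagrangian L)
    (w : Conf d → ℝ) (hw : Continuous w)
    (hw_lower : ∃ α : ℝ, 0 ≤ α ∧ ∃ β : ℝ, ∀ x, -α * ‖x‖ + β ≤ w x)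
    (t : ℝ) (ht : 0 < t) :
    -- the action is a genuine real number on Lipschitz curves
    (∀ γ ∈ LipschitzCurves d t,
      IntervalIntegrable (lagrangianAlong L t γ) volume 0 t) ∧
    -- end point fixed at time `t`, free at time `0`
    (∀ (x : Conf d) (γs : ℝ → Conf d),
      IsMinimizerIn (action L w t) {γ | γ ∈ PiecewiseC1 d t ∧ γ t = x} γs →
      IsMinimizerIn (action L w t) {γ | γ ∈ LipschitzCurves d t ∧ γ t = x} γs) ∧
    -- both end points fixed, no initial cost
    (∀ (x x' : Conf d) (γs : ℝ → Conf d),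
      IsMinimizerIn (action L (fun _ => 0) t)
        {γ | γ ∈ PiecewiseC1 d t ∧ γ t = x ∧ γ 0 = x'} γs →
      IsMinimizerIn (action L (fun _ => 0) t)
        {γ | γ ∈ LipschitzCurves d t ∧ γ t = x ∧ γ 0 = x'} γs) := by
  have hLc := hL.contDiff.continuous
  refine ⟨fun γ hγ => intervalIntegrable_lagrangianAlong hLc ht.le hγ, ?_, ?_⟩
  · rintro x γs ⟨⟨hγs, hx⟩, hmin⟩
    refine ⟨⟨piecewiseC1_subset_lipschitzCurves d t hγs, hx⟩, ?_⟩
    rintro γ ⟨hγ, hγt⟩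
    exact le_action_of_forall_contDiff hLc w ht hγ fun η hη _ hηt =>
      hmin η ⟨hη.mem_piecewiseC1 ht, hηt.trans hγt⟩
  · rintro x x' γs ⟨⟨hγs, hx, hx'⟩, hmin⟩
    refine ⟨⟨piecewiseC1_subset_lipschitzCurves d t hγs, hx, hx'⟩, ?_⟩
    rintro γ ⟨hγ, hγt, hγ0⟩
    exact le_action_of_forall_contDiff hLc _ ht hγ fun η hη hη0 hηt =>
      hmin η ⟨hη.mem_piecewiseC1 ht, hηt.trans hγt, hη0.trans hγ0⟩
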